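/- Let $K\subset\mathbb R^n$ be a convex body, i.e. a bounded, open convex set. Let $\psi,\varphi:\mathbb R^n\to\mathbb R$ be $C^\infty$-smooth with $\psi$ convex, $\rho_\psi(x):=\det\nabla^2\psi(x)>0$ for all $x\in\mathbb R^n$, $\inf\varphi>-\infty$ and $\nabla\psi(\mathbb R^n)=K$. Subscripts denote partial derivatives, $(\psi^{ij})$ is the inverse of the matrix $(\psi_{ij})=\nabla^2\psi$, and $\psi_{i\ell}^k=\sum_m\psi^{km}\psi_{i\ell m}$. Let $\psi^*(x)=\sup_{y\in\mathbb R^n}[\langle x,y\rangle-\psi(y)]$ for $x\in K$, so that $\nabla\psi^*:K\to\mathbb R^n$ is the inverse of $\nabla\psi$. For $x\in K$ and $U,V\in\mathbb R^n$ put $$Q^*_{\psi,x}(V)=\sum_{i,j,k,\ell,m,p=1}^n V^iV^j\psi^{\ell m}\psi_{jkm}\psi^{kp}\psi_{i\ell p},\qquad Q_{\psi,x}(U)=\sup\Big\{4\Big(\sum_{i,j=1}^n\psi_{ij}U^iV^j\Big)^2\,;\ V\in\mathbb R^n,\ Q^*_{\psi,x}(V)\le 1\Big\}\in[0,\infty],$$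 where the derivatives of $\psi$ are evaluated at $\nabla\psi^*(x)$. Let $\mu$ be the measure on $\mathbb R^n$ with density $e^{-\varphi}\rho_\psi$ with respect to Lebesgue measure, and write $$\langle\nabla^\psi u,\nabla^\psi h\rangle=\sum_{i,j}\psi^{ij}u_ih_j,\qquad |\nabla^\psi u|^2=\langle\nabla^\psi u,\nabla^\psi u\rangle,\qquad \Delta^\mu u=\sum_{i,j}\psi^{ij}u_{ij}-\sum_{i,j}\psi^{ij}u_i\varphi_j .$$ Assume: ($\star$) for every $x\in\mathbb R^n$ the matrix $\Big(\varphi_{i\ell}-\frac12\sum_k\psi^k_{i\ell}\varphi_k-\frac12\frac{\partial^2\log\rho_\psi}{\partial x_i\partial x_\ell}\Big)_{i,\ell=1,\dots,n}$ is positive semi-definite; and that $(\psi,\varphi)$ is regular at infinity, i.e. there is a linear space $X$ of smooth functions $u:\mathbb R^n\to\mathbb R$ such that (a) for all $u,h\in X$, the functions $h\,\Delta^\mu u$ and $\langle\nabla^\psi u,\nabla^\psi h\rangle$ belong to $L^1(\mu)$ and $\int h\,\Delta^\mu u\,d\mu=-\int\langle\nabla^\psi u,\nabla^\psi h\rangle\,d\mu$;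 the same holds whenever $u\in X$ and $h:\mathbb R^n\to\mathbb R$ is such that $h\circ\nabla\psi^*$ is Lipschitz on $K$; (b) $X$ contains the constant functions, and $u\in X$ implies $\Delta^\mu u\in X$ and $|\nabla^\psi u|^2\in X$; (c) $\{\Delta^\mu u\,;\,u\in X\}$ is dense, in the topology of $L^2(\mu)$, in $\{g\in L^2(\mu)\,;\,\int g\,d\mu=0\}$. Let $\nu$ be the push-forward of $\mu$ under $\nabla\psi$. Then $\nu$ is a finite Borel measure concentrated on $K$, and for any Lipschitz function $f:K\to\mathbb R$, $$\int_K f\,d\nu=0\quad\Longrightarrow\quad\int_K f^2\,d\nu\le\int_K Q_{\psi,x}(\nabla f(x))\,d\nu(x),$$ where the right-hand side may be $+\infty$. -/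

import Mathlib

open MeasureTheory Set
open scoped ENNReal NNReal ContDiff

namespace ToricPoincare

noncomputable section

/-- The partial derivative `∂f/∂xᵢ` of a function on `ℝⁿ`. -/
def pd {n : ℕ} (i : Fin n) (f : EuclideanSpace ℝ (Fin n) → ℝ) :
    EuclideanSpace ℝ (Fin n) → ℝ :=
  fun x => fderiv ℝ f x (EuclideanSpace.single i 1)

/-- The Hessian matrix `(f_{ij})`. -/
def hess {n : ℕ} (f : EuclideanSpace ℝ (Fin n) → ℝ) (x : EuclideanSpace ℝ (Fin n)) :
    Matrix (Fin n) (Fin n) ℝ :=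
  Matrix.of fun i j => pd j (pd i f) x

/-- The third derivatives `f_{ijk}`. -/
def third {n : ℕ} (f : EuclideanSpace ℝ (Fin n) → ℝ) (x : EuclideanSpace ℝ (Fin n))
    (i j k : Fin n) : ℝ :=
  pd k (pd j (pd i f)) x

/-- `ψ^{ij}`: the inverse of the Hessian matrix of `ψ`. -/
def hessInv {n : ℕ} (ψ : EuclideanSpace ℝ (Fin n) → ℝ) (x : EuclideanSpace ℝ (Fin n)) :
    Matrix (Fin n) (Fin n) ℝ :=
  (hess ψ x)⁻¹

/-- `ρ_ψ = det ∇²ψ`. -/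
def rho {n : ℕ} (ψ : EuclideanSpace ℝ (Fin n) → ℝ) (x : EuclideanSpace ℝ (Fin n)) : ℝ :=
  (hess ψ x).det

/-- The Legendre transform `ψ*(x) = sup_y [⟨x, y⟩ - ψ(y)]`. At the points `x = ∇ψ(y)` of a convex
function `ψ`, the only ones where it is used, the supremum is a maximum. -/
def legendre {n : ℕ} (ψ : EuclideanSpace ℝ (Fin n) → ℝ) (x : EuclideanSpace ℝ (Fin n)) : ℝ :=
  ⨆ y : EuclideanSpace ℝ (Fin n), (inner ℝ x y - ψ y)

/-- `Q*_{ψ,x}(V) = ∑ Vⁱ Vʲ ψ^{ℓm} ψ_{jkm} ψ^{kp} ψ_{iℓp}`, the coefficients being evaluated at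
`∇ψ*(x)`. -/
def QStar {n : ℕ} (ψ : EuclideanSpace ℝ (Fin n) → ℝ) (x V : EuclideanSpace ℝ (Fin n)) : ℝ :=
  ∑ i, ∑ j, ∑ k, ∑ l, ∑ m, ∑ p,
    V i * V j * hessInv ψ (gradient (legendre ψ) x) l m * third ψ (gradient (legendre ψ) x) j k m *
      hessInv ψ (gradient (legendre ψ) x) k p * third ψ (gradient (legendre ψ) x) i l p

/-- `Q_{ψ,x}(U) = sup {4 (∑ ψ_{ij} Uⁱ Vʲ)² : Q*_{ψ,x}(V) ≤ 1} ∈ [0, ∞]`, with `ψ_{ij}` evaluated at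
`∇ψ*(x)`. -/
def Q {n : ℕ} (ψ : EuclideanSpace ℝ (Fin n) → ℝ) (x U : EuclideanSpace ℝ (Fin n)) : ℝ≥0∞ :=
  ⨆ (V : EuclideanSpace ℝ (Fin n)) (_ : QStar ψ x V ≤ 1),
    ENNReal.ofReal
      (4 * (∑ i, ∑ j, hess ψ (gradient (legendre ψ) x) i j * U i * V j) ^ 2)

/-- The measure `exp(-φ(x)) ρ_ψ(x) dx` on `ℝⁿ`. (On functions of `x` alone, integration against it
is integration over `ℝⁿ × (ℝ/ℤ)ⁿ` against the product with the Haar probability of the torus.) -/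
def mu {n : ℕ} (ψ φ : EuclideanSpace ℝ (Fin n) → ℝ) : Measure (EuclideanSpace ℝ (Fin n)) :=
  volume.withDensity fun x => ENNReal.ofReal (Real.exp (-φ x) * rho ψ x)

/-- The push-forward of `mu ψ φ` under `∇ψ`. -/
def nu {n : ℕ} (ψ φ : EuclideanSpace ℝ (Fin n) → ℝ) : Measure (EuclideanSpace ℝ (Fin n)) :=
  (mu ψ φ).map (gradient ψ)

/-- `⟨∇^ψ u, ∇^ψ h⟩ = ∑ ψ^{ij} u_i h_j`, the inner product of the Riemannian gradients. -/
def gradInner {n : ℕ} (ψ u h : EuclideanSpace ℝ (Fin n) → ℝ) :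
    EuclideanSpace ℝ (Fin n) → ℝ :=
  fun x => ∑ i, ∑ j, hessInv ψ x i j * pd i u x * pd j h x

/-- `Δ^μ u = ∑ ψ^{ij} u_{ij} - ∑ ψ^{ij} u_i φ_j`. -/
def lap {n : ℕ} (ψ φ u : EuclideanSpace ℝ (Fin n) → ℝ) : EuclideanSpace ℝ (Fin n) → ℝ :=
  fun x => (∑ i, ∑ j, hessInv ψ x i j * hess u x i j) -
    ∑ i, ∑ j, hessInv ψ x i j * pd i u x * pd j φ x

/-- Condition (⋆): for every `x` the matrix
`φ_{iℓ} - ½ ∑_k ψ^k_{iℓ} φ_k - ½ ∂² log ρ_ψ / ∂x_i ∂x_ℓ`, with `ψ^k_{iℓ} = ∑_m ψ^{km} ψ_{iℓm}`,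
is positive semi-definite. -/
def StarCondition {n : ℕ} (ψ φ : EuclideanSpace ℝ (Fin n) → ℝ) : Prop :=
  ∀ x : EuclideanSpace ℝ (Fin n),
    (Matrix.of fun i l : Fin n =>
      hess φ x i l
        - (1 / 2 : ℝ) * ∑ k, (∑ m, hessInv ψ x k m * third ψ x i l m) * pd k φ x
        - (1 / 2 : ℝ) * hess (fun y => Real.log (rho ψ y)) x i l).PosSemidef

/-- `h Δ^μ u` and `⟨∇^ψ u, ∇^ψ h⟩` are `μ`-integrable, and
`∫ h Δ^μ u dμ = -∫ ⟨∇^ψ u, ∇^ψ h⟩ dμ`. -/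
def IntegratesByParts {n : ℕ} (ψ φ u h : EuclideanSpace ℝ (Fin n) → ℝ) : Prop :=
  Integrable (fun x => h x * lap ψ φ u x) (mu ψ φ) ∧
    Integrable (gradInner ψ u h) (mu ψ φ) ∧
    ∫ x, h x * lap ψ φ u x ∂(mu ψ φ) = -∫ x, gradInner ψ u h x ∂(mu ψ φ)

/-- The pair `(ψ, φ)`, where `∇ψ(ℝⁿ) = K`, is regular at infinity. -/
def RegularAtInfinity {n : ℕ} (K : Set (EuclideanSpace ℝ (Fin n)))
    (ψ φ : EuclideanSpace ℝ (Fin n) → ℝ) : Prop :=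
  ∃ X : Submodule ℝ (EuclideanSpace ℝ (Fin n) → ℝ),
    (∀ u ∈ X, ContDiff ℝ ∞ u) ∧
    -- (a)
    (∀ u ∈ X, ∀ h ∈ X, IntegratesByParts ψ φ u h) ∧
    (∀ u ∈ X, ∀ h : EuclideanSpace ℝ (Fin n) → ℝ,
      (∃ C : ℝ≥0, LipschitzOnWith C (fun x => h (gradient (legendre ψ) x)) K) →
        IntegratesByParts ψ φ u h) ∧
    -- (b)
    (∀ c : ℝ, (fun _ => c) ∈ X) ∧
    (∀ u ∈ X, lap ψ φ u ∈ X) ∧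
    (∀ u ∈ X, gradInner ψ u u ∈ X) ∧
    -- (c)
    (∀ g : EuclideanSpace ℝ (Fin n) → ℝ, MemLp g 2 (mu ψ φ) → ∫ x, g x ∂(mu ψ φ) = 0 →
      ∀ ε : ℝ≥0∞, 0 < ε → ∃ u ∈ X, eLpNorm (fun x => lap ψ φ u x - g x) 2 (mu ψ φ) < ε)

end

end ToricPoincare

/-!
Let `ℝⁿ` carry the Riemannian metric `∇²ψ` and the weight `e^{-φ} ρ_ψ dx`, for which `Δ^μ` is the
divergence of the gradient. Its Bochner formula reads
`½ Δ^μ |∇^ψ u|² - ⟨∇^ψ u, ∇^ψ Δ^μ u⟩ = S(V) + ¼ Q*(V) + |Hess^ψ u|²`, where `V = ∇^ψ u` and `S` is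
the quadratic form of (⋆). It follows from `∇^ψ |∇^ψ u|² = 2 D_V V + (∇²ψ)⁻¹ (∇³ψ)(V, V)` by taking
weighted divergences. As `S` and `|Hess^ψ u|²` are nonnegative, integration by parts gives
`∫ Q*(∇^ψ u) dμ ≤ 4 ∫ (Δ^μ u)² dμ`.

The Poincaré inequality is dual to this: `4 ⟨U, ∇²ψ V⟩ - Q*(V) ≤ Q(U)`, and with `U = ∇f ∘ ∇ψ`,
`V = ∇^ψ u` the integral of the left-hand side is at least
`-4 ∫ (f ∘ ∇ψ) Δ^μ u dμ - 4 ∫ (Δ^μ u)² dμ`, which tends to `∫ f² dν` as `Δ^μ u` tends to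
`-½ f ∘ ∇ψ` in `L²(μ)`.
-/

namespace ToricPoincare

open Filter Topology

section SecondDerivative

variable {F G : Type*} [NormedAddCommGroup F] [NormedSpace ℝ F] [NormedAddCommGroup G]
  [NormedSpace ℝ G] {X : F → G}

lemma hasFDerivAt_fderiv (hX : ContDiff ℝ 2 X) (x : F) :
    HasFDerivAt (fderiv ℝ X) (fderiv ℝ (fderiv ℝ X) x) x :=
  ((hX.fderiv_right (m := 1) le_rfl).differentiable (by simp) x).hasFDerivAt

lemma fderiv_fderiv_comm (hX : ContDiff ℝ 2 X) (x v w : F) :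
    fderiv ℝ (fderiv ℝ X) x v w = fderiv ℝ (fderiv ℝ X) x w v :=
  hX.contDiffAt.isSymmSndFDerivAt (by simp) v w

end SecondDerivative

section Trace

lemma det_ne_zero_of_isUnit {V : Type*} [NormedAddCommGroup V] [NormedSpace ℝ V] {A : V →L[ℝ] V}
    (hA : IsUnit A) : A.det ≠ 0 :=
  (hA.map ContinuousLinearMap.toLinearMapRingHom |>.map (LinearMap.det (M := V))).ne_zero

variable {E : Type*} [NormedAddCommGroup E] [NormedSpace ℝ E] [FiniteDimensional ℝ E]

/-- The trace, as a continuous linear functional on the endomorphisms of a finite-dimensional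
space. -/
noncomputable def traceCLM : (E →L[ℝ] E) →L[ℝ] ℝ :=
  LinearMap.toContinuousLinearMap (LinearMap.trace ℝ E ∘ₗ ContinuousLinearMap.coeLM ℝ)

lemma traceCLM_apply (A : E →L[ℝ] E) : traceCLM A = LinearMap.trace ℝ E A := rfl

lemma traceCLM_mul_comm (A B : E →L[ℝ] E) : traceCLM (A * B) = traceCLM (B * A) :=
  LinearMap.trace_mul_comm ℝ (A : E →ₗ[ℝ] E) B

lemma contDiff_det {k : WithTop ℕ∞} : ContDiff ℝ k fun A : E →L[ℝ] E => A.det := by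
  let b := Module.finBasis ℝ E
  have hdet (A : E →L[ℝ] E) : A.det =
      ∑ σ : Equiv.Perm _, (Equiv.Perm.sign σ : ℤ) * ∏ i, b.coord (σ i) (A (b i)) := by
    rw [ContinuousLinearMap.det, ← LinearMap.det_toMatrix b, Matrix.det_apply']
    simp [LinearMap.toMatrix_apply]
  have hentry (i j) : ContDiff ℝ k fun A : E →L[ℝ] E => b.coord i (A (b j)) :=
    (LinearMap.toContinuousLinearMap (b.coord i)).contDiff.comp (by fun_prop)
  simp_rw [hdet]
  exact ContDiff.sum fun σ _ => contDiff_const.mul (contDiff_prod fun i _ => hentry _ _)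

lemma hasDerivAt_det_one_add_smul (B : E →L[ℝ] E) :
    HasDerivAt (fun t : ℝ => (1 + t • B).det) (traceCLM B) 0 := by
  let b := Module.finBasis ℝ E
  let M := LinearMap.toMatrix b b B
  have hdet (t : ℝ) : (1 + t • B).det = (1 + t • M).det := by
    rw [ContinuousLinearMap.det, ← LinearMap.det_toMatrix b, ContinuousLinearMap.toLinearMap_add,
      ContinuousLinearMap.toLinearMap_smul, map_add, map_smul]
    exact congrArg (fun N => (N + t • M).det) (LinearMap.toMatrix_one b)
  obtain ⟨p, hp⟩ : ∃ p : Polynomial ℝ,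
      ∀ t, (1 + t • M).det = 1 + M.trace * t + p.eval t * t ^ 2 :=
    ⟨_, fun t => Matrix.det_one_add_smul t M⟩
  simp_rw [hdet, hp, traceCLM_apply, LinearMap.trace_eq_matrix_trace ℝ b]
  exact ((((hasDerivAt_id (0 : ℝ)).const_mul M.trace).const_add 1).add
    ((p.hasDerivAt 0).mul ((hasDerivAt_id (0 : ℝ)).pow 2))).congr_deriv (by simp [M])

lemma hasFDerivAt_det {A : E →L[ℝ] E} (hA : IsUnit A) :
    HasFDerivAt (fun B : E →L[ℝ] E => B.det)
      (A.det • traceCLM ∘L ContinuousLinearMap.mul ℝ (E →L[ℝ] E) (Ring.inverse A)) A := by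
  have hd := ((contDiff_det (k := 1)).differentiable one_ne_zero A).hasFDerivAt
  refine hd.congr_fderiv (ContinuousLinearMap.ext fun B => ?_)
  have hline : HasDerivAt (fun t : ℝ => A + t • B) B 0 := by
    simpa using ((hasDerivAt_id (0 : ℝ)).smul_const B).const_add A
  have hchain := HasFDerivAt.comp_hasDerivAt (l := fun B : E →L[ℝ] E => B.det) 0
    (by simpa using hd) hline
  have hfactor (t : ℝ) : (A + t • B).det = A.det * (1 + t • (Ring.inverse A * B)).det := by
    have : A + t • B = A * (1 + t • (Ring.inverse A * B)) := by
      rw [mul_add, mul_one, mul_smul_comm, Ring.mul_inverse_cancel_left _ _ hA]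
    rw [this]
    exact LinearMap.det_comp _ _
  refine hchain.unique ?_
  simpa [Function.comp_def, hfactor] using
    (hasDerivAt_det_one_add_smul (Ring.inverse A * B)).const_mul A.det

/-- The divergence of a vector field. -/
noncomputable def divergence (X : E → E) (x : E) : ℝ :=
  traceCLM (fderiv ℝ X x)

lemma hasFDerivAt_divergence {X : E → E} (hX : ContDiff ℝ 2 X) (x : E) :
    HasFDerivAt (divergence X) (traceCLM ∘L fderiv ℝ (fderiv ℝ X) x) x :=
  (traceCLM (E := E)).hasFDerivAt.comp x (hasFDerivAt_fderiv hX x)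

lemma divergence_fderiv_apply_self {X : E → E} {x : E} (hX : ContDiff ℝ 2 X) :
    divergence (fun y => fderiv ℝ X y (X y)) x =
      fderiv ℝ (divergence X) x (X x) + traceCLM (fderiv ℝ X x * fderiv ℝ X x) := by
  have hd : HasFDerivAt X (fderiv ℝ X x) x := (hX.differentiable (by simp) x).hasFDerivAt
  have hdd := hasFDerivAt_fderiv hX x
  have hdiv : fderiv ℝ (divergence X) x (X x) = traceCLM (fderiv ℝ (fderiv ℝ X) x (X x)) :=
    congrArg (fun L => L (X x)) (hasFDerivAt_divergence hX x).fderiv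
  rw [hdiv, divergence, (hdd.clm_apply hd).fderiv, map_add, add_comm]
  congr 2
  ext v
  exact fderiv_fderiv_comm hX x v (X x)

end Trace

section HessianOperator

variable {E : Type*} [NormedAddCommGroup E] [InnerProductSpace ℝ E] [CompleteSpace E]
  {f : E → ℝ}

/-- The Hessian of `f` at `x`, as an operator on a Hilbert space. -/
noncomputable def hessOp (f : E → ℝ) (x : E) : E →L[ℝ] E :=
  fderiv ℝ (gradient f) x

lemma contDiff_gradient (hf : ContDiff ℝ ∞ f) : ContDiff ℝ ∞ (gradient f) :=
  (InnerProductSpace.toDual ℝ E).symm.contDiff.comp (hf.fderiv_right (m := ∞) le_rfl)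

lemma contDiff_hessOp (hf : ContDiff ℝ ∞ f) : ContDiff ℝ ∞ (hessOp f) :=
  (contDiff_gradient hf).fderiv_right le_rfl

lemma hasFDerivAt_gradient (hf : ContDiff ℝ ∞ f) (x : E) :
    HasFDerivAt (gradient f) (hessOp f x) x :=
  ((contDiff_gradient hf).differentiable (by simp) x).hasFDerivAt

lemma hasFDerivAt_hessOp (hf : ContDiff ℝ ∞ f) (x : E) :
    HasFDerivAt (hessOp f) (fderiv ℝ (hessOp f) x) x :=
  ((contDiff_hessOp hf).differentiable (by simp) x).hasFDerivAt

lemma inner_hessOp_apply (hf : ContDiff ℝ ∞ f) (x v w : E) :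
    inner ℝ (hessOp f x v) w = fderiv ℝ (fderiv ℝ f) x v w := by
  have h : HasFDerivAt (fun y => inner ℝ (gradient f y) w) _ x :=
    (hasFDerivAt_gradient hf x).inner ℝ (hasFDerivAt_const w x)
  have h' : HasFDerivAt (fun y => fderiv ℝ f y w) _ x :=
    (hasFDerivAt_fderiv (hf.of_le ENat.LEInfty.out) x).clm_apply (hasFDerivAt_const w x)
  simp only [inner_gradient_left] at h
  simpa using congrArg (fun L => L v) (h.unique h')

lemma inner_hessOp_comm (hf : ContDiff ℝ ∞ f) (x v w : E) :
    inner ℝ (hessOp f x v) w = inner ℝ v (hessOp f x w) := by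
  rw [real_inner_comm _ v, inner_hessOp_apply hf, inner_hessOp_apply hf]
  exact fderiv_fderiv_comm (hf.of_le ENat.LEInfty.out) x v w

lemma isSelfAdjoint_hessOp (hf : ContDiff ℝ ∞ f) (x : E) : IsSelfAdjoint (hessOp f x) :=
  ContinuousLinearMap.isSelfAdjoint_iff_isSymmetric.2 fun v w => inner_hessOp_comm hf x v w

lemma isSelfAdjoint_fderiv_hessOp (hf : ContDiff ℝ ∞ f) (x v : E) :
    IsSelfAdjoint (fderiv ℝ (hessOp f) x v) := by
  have h : HasFDerivAt (fun y => star (hessOp f y)) _ x := (hasFDerivAt_hessOp hf x).star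
  simp only [(isSelfAdjoint_hessOp hf _).star_eq] at h
  exact congrArg (fun L => L v) (h.unique (hasFDerivAt_hessOp hf x))

lemma fderiv_hessOp_comm (hf : ContDiff ℝ ∞ f) (x v w : E) :
    fderiv ℝ (hessOp f) x v w = fderiv ℝ (hessOp f) x w v :=
  fderiv_fderiv_comm ((contDiff_gradient hf).of_le ENat.LEInfty.out) x v w

lemma fderiv_fderiv_hessOp_comm (hf : ContDiff ℝ ∞ f) (x u v w : E) :
    fderiv ℝ (fderiv ℝ (hessOp f)) x u v w = fderiv ℝ (fderiv ℝ (hessOp f)) x u w v := by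
  have hd := hasFDerivAt_fderiv ((contDiff_hessOp hf).of_le ENat.LEInfty.out) x
  have h (a b : E) : HasFDerivAt (fun y => fderiv ℝ (hessOp f) y a b) _ x :=
    (hd.clm_apply (hasFDerivAt_const a x)).clm_apply (hasFDerivAt_const b x)
  have h' := h v w
  simp only [fderiv_hessOp_comm hf _ v w] at h'
  simpa using congrArg (fun L => L u) (h'.unique (h w v))

lemma fderiv_fderiv_hessOp_swap (hf : ContDiff ℝ ∞ f) (x u v : E) :
    fderiv ℝ (fderiv ℝ (hessOp f)) x u v = fderiv ℝ (fderiv ℝ (hessOp f)) x v u :=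
  fderiv_fderiv_comm ((contDiff_hessOp hf).of_le ENat.LEInfty.out) x u v

end HessianOperator

section HessianMetric

variable {E : Type*} [NormedAddCommGroup E] [InnerProductSpace ℝ E] [CompleteSpace E]
  {ψ u : E → ℝ}

/-- The inverse of the Hessian of `ψ`, i.e. the metric which `∇²ψ` induces on covectors. -/
noncomputable def hessOpInv (ψ : E → ℝ) (x : E) : E →L[ℝ] E :=
  Ring.inverse (hessOp ψ x)

/-- The gradient of `u` for the Riemannian metric `∇²ψ`. -/
noncomputable def rgrad (ψ u : E → ℝ) (x : E) : E :=
  hessOpInv ψ x (gradient u x)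

lemma hessOp_hessOpInv {x : E} (hx : IsUnit (hessOp ψ x)) (v : E) :
    hessOp ψ x (hessOpInv ψ x v) = v :=
  congrArg (fun L => L v) (Ring.mul_inverse_cancel _ hx)

lemma isSelfAdjoint_hessOpInv (hψ : ContDiff ℝ ∞ ψ) (x : E) : IsSelfAdjoint (hessOpInv ψ x) :=
  (isSelfAdjoint_hessOp hψ x).ringInverse

lemma inner_hessOpInv_comm (hψ : ContDiff ℝ ∞ ψ) (x v w : E) :
    inner ℝ (hessOpInv ψ x v) w = inner ℝ v (hessOpInv ψ x w) :=
  (isSelfAdjoint_hessOpInv hψ x).isSymmetric v w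

lemma contDiff_hessOpInv (hψ : ContDiff ℝ ∞ ψ) (hg : ∀ x, IsUnit (hessOp ψ x)) :
    ContDiff ℝ ∞ (hessOpInv ψ) :=
  contDiff_iff_contDiffAt.2 fun x => by
    obtain ⟨g, hg⟩ := hg x
    exact ContDiffAt.comp x (hg ▸ contDiffAt_ringInverse ℝ g) (contDiff_hessOp hψ).contDiffAt

lemma contDiff_rgrad (hψ : ContDiff ℝ ∞ ψ) (hg : ∀ x, IsUnit (hessOp ψ x))
    (hu : ContDiff ℝ ∞ u) : ContDiff ℝ ∞ (rgrad ψ u) :=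
  (contDiff_hessOpInv hψ hg).clm_apply (contDiff_gradient hu)

lemma hasFDerivAt_hessOpInv (hψ : ContDiff ℝ ∞ ψ) {x : E} (hx : IsUnit (hessOp ψ x)) :
    HasFDerivAt (hessOpInv ψ)
      (-ContinuousLinearMap.mulLeftRight ℝ (E →L[ℝ] E) (hessOpInv ψ x) (hessOpInv ψ x) ∘L
        fderiv ℝ (hessOp ψ) x) x := by
  have hinv := hasFDerivAt_ringInverse (𝕜 := ℝ) hx.unit
  rw [IsUnit.unit_spec, ← Ring.inverse_of_isUnit hx] at hinv
  exact hinv.comp x (hasFDerivAt_hessOp hψ x)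

lemma hasFDerivAt_hessOpInv_apply (hψ : ContDiff ℝ ∞ ψ) {x : E} (hx : IsUnit (hessOp ψ x))
    {S : E → E} {S' : E →L[ℝ] E} (hS : HasFDerivAt S S' x) :
    HasFDerivAt (fun y => hessOpInv ψ y (S y))
      (hessOpInv ψ x * (S' - fderiv ℝ (hessOp ψ) x (hessOpInv ψ x (S x)))) x := by
  refine ((hasFDerivAt_hessOpInv hψ hx).clm_apply hS).congr_fderiv ?_
  ext v
  simp [fderiv_hessOp_comm hψ x v, sub_eq_add_neg]

lemma hasFDerivAt_rgrad (hψ : ContDiff ℝ ∞ ψ) {x : E} (hx : IsUnit (hessOp ψ x))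
    (hu : ContDiff ℝ ∞ u) :
    HasFDerivAt (rgrad ψ u)
      (hessOpInv ψ x * (hessOp u x - fderiv ℝ (hessOp ψ) x (rgrad ψ u x))) x :=
  hasFDerivAt_hessOpInv_apply hψ hx (hasFDerivAt_gradient hu x)

lemma hasGradientAt_fderiv_rgrad (hψ : ContDiff ℝ ∞ ψ) {x : E} (hx : IsUnit (hessOp ψ x))
    (hu : ContDiff ℝ ∞ u) :
    HasGradientAt (fun y => fderiv ℝ u y (rgrad ψ u y))
      ((2 : ℝ) • hessOp u x (rgrad ψ u x) -
        fderiv ℝ (hessOp ψ) x (rgrad ψ u x) (rgrad ψ u x)) x := by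
  set V := rgrad ψ u x
  set M := hessOp u x - fderiv ℝ (hessOp ψ) x V with hM
  have hMsymm : IsSelfAdjoint M :=
    (isSelfAdjoint_hessOp hu x).sub (isSelfAdjoint_fderiv_hessOp hψ x V)
  have hdu := hasFDerivAt_fderiv (hu.of_le ENat.LEInfty.out) x
  refine hasGradientAt_iff_hasFDerivAt.2
    ((hdu.clm_apply (hasFDerivAt_rgrad hψ hx hu)).congr_fderiv
      (ContinuousLinearMap.ext fun v => ?_))
  have hleft : fderiv ℝ u x (hessOpInv ψ x (M v)) = inner ℝ (M V) v := calc
    _ = inner ℝ (gradient u x) (hessOpInv ψ x (M v)) := inner_gradient_left.symm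
    _ = inner ℝ V (M v) := (inner_hessOpInv_comm hψ x _ _).symm
    _ = inner ℝ (M V) v := (hMsymm.isSymmetric V v).symm
  have hright : fderiv ℝ (fderiv ℝ u) x v V = inner ℝ (hessOp u x V) v := by
    rw [fderiv_fderiv_comm (hu.of_le ENat.LEInfty.out), inner_hessOp_apply hu]
  calc fderiv ℝ u x (hessOpInv ψ x (M v)) + fderiv ℝ (fderiv ℝ u) x v V
      = inner ℝ (M V + hessOp u x V) v := by rw [hleft, hright, inner_add_left]
    _ = inner ℝ ((2 : ℝ) • hessOp u x V - fderiv ℝ (hessOp ψ) x V V) v := by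
      congr 1
      simp only [hM, sub_apply]
      module

lemma rgrad_fderiv_rgrad (hψ : ContDiff ℝ ∞ ψ) {x : E} (hx : IsUnit (hessOp ψ x))
    (hu : ContDiff ℝ ∞ u) :
    rgrad ψ (fun y => fderiv ℝ u y (rgrad ψ u y)) x =
      (2 : ℝ) • fderiv ℝ (rgrad ψ u) x (rgrad ψ u x) +
        hessOpInv ψ x (fderiv ℝ (hessOp ψ) x (rgrad ψ u x) (rgrad ψ u x)) := by
  rw [rgrad, (hasGradientAt_fderiv_rgrad hψ hx hu).gradient, (hasFDerivAt_rgrad hψ hx hu).fderiv]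
  simp only [map_sub, map_smul, mul_apply_eq_comp, sub_apply]
  module

/-- The Hessian of `u` for the Riemannian metric `∇²ψ`, whose Christoffel symbols are
`½ ψ^k_{ij}`. -/
noncomputable def rhess (ψ u : E → ℝ) (x : E) : E →L[ℝ] E :=
  hessOp u x - (1 / 2 : ℝ) • fderiv ℝ (hessOp ψ) x (rgrad ψ u x)

lemma isSelfAdjoint_rhess (hψ : ContDiff ℝ ∞ ψ) (hu : ContDiff ℝ ∞ u) (x : E) :
    IsSelfAdjoint (rhess ψ u x) := by
  have hT : IsSelfAdjoint ((1 / 2 : ℝ) • fderiv ℝ (hessOp ψ) x (rgrad ψ u x)) := by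
    rw [IsSelfAdjoint, star_smul, (isSelfAdjoint_fderiv_hessOp hψ x _).star_eq, star_trivial]
  exact (isSelfAdjoint_hessOp hu x).sub hT

end HessianMetric

section BochnerFormula

variable {E : Type*} [NormedAddCommGroup E] [InnerProductSpace ℝ E] [FiniteDimensional ℝ E]
  {ψ φ u : E → ℝ}

/-- `log ρ_ψ`, where `ρ_ψ = det ∇²ψ`. -/
noncomputable def logDetHess (ψ : E → ℝ) (x : E) : ℝ :=
  Real.log (hessOp ψ x).det

lemma hasFDerivAt_logDetHess (hψ : ContDiff ℝ ∞ ψ) {x : E} (hx : IsUnit (hessOp ψ x)) :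
    HasFDerivAt (logDetHess ψ) (traceCLM ∘L ContinuousLinearMap.mul ℝ (E →L[ℝ] E)
      (hessOpInv ψ x) ∘L fderiv ℝ (hessOp ψ) x) x := by
  refine (((hasFDerivAt_det hx).comp x (hasFDerivAt_hessOp hψ x)).log
    (det_ne_zero_of_isUnit hx)).congr_fderiv ?_
  ext v
  simp [hessOpInv, det_ne_zero_of_isUnit hx]

lemma fderiv_logDetHess (hψ : ContDiff ℝ ∞ ψ) {x : E} (hx : IsUnit (hessOp ψ x)) (v : E) :
    fderiv ℝ (logDetHess ψ) x v = traceCLM (hessOpInv ψ x * fderiv ℝ (hessOp ψ) x v) := by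
  rw [(hasFDerivAt_logDetHess hψ hx).fderiv]
  rfl

lemma contDiff_logDetHess (hψ : ContDiff ℝ ∞ ψ) (hg : ∀ x, IsUnit (hessOp ψ x)) :
    ContDiff ℝ ∞ (logDetHess ψ) :=
  (contDiff_det.comp (contDiff_hessOp hψ)).log fun x => det_ne_zero_of_isUnit (hg x)

lemma fderiv_fderiv_logDetHess (hψ : ContDiff ℝ ∞ ψ) (hg : ∀ x, IsUnit (hessOp ψ x)) (x v : E) :
    fderiv ℝ (fderiv ℝ (logDetHess ψ)) x v v =
      traceCLM (hessOpInv ψ x * fderiv ℝ (fderiv ℝ (hessOp ψ)) x v v) -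
        traceCLM (hessOpInv ψ x * fderiv ℝ (hessOp ψ) x v *
          (hessOpInv ψ x * fderiv ℝ (hessOp ψ) x v)) := by
  have hdd := hasFDerivAt_fderiv ((contDiff_logDetHess hψ hg).of_le ENat.LEInfty.out) x
  have hdT := hasFDerivAt_fderiv ((contDiff_hessOp hψ).of_le ENat.LEInfty.out) x
  have hmul := (ContinuousLinearMap.mul ℝ (E →L[ℝ] E)).hasFDerivAt_of_bilinear
    (hasFDerivAt_hessOpInv hψ (hg x)) (hdT.clm_apply (hasFDerivAt_const v x))
  have hright := (traceCLM.hasFDerivAt.comp x hmul).congr_of_eventuallyEq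
    (Eventually.of_forall fun y => fderiv_logDetHess hψ (hg y) v)
  have h := congrArg (fun L => L v) ((hdd.clm_apply (hasFDerivAt_const v x)).unique hright)
  simpa [mul_assoc, sub_eq_add_neg] using h

/-- The weighted divergence `div X - ⟨∇Φ, X⟩` with `Φ = φ - log ρ_ψ`, i.e. the divergence with
respect to the measure `e^{-φ} ρ_ψ dx`. -/
noncomputable def weightedDiv (ψ φ : E → ℝ) (X : E → E) (x : E) : ℝ :=
  divergence X x + fderiv ℝ (logDetHess ψ) x (X x) - fderiv ℝ φ x (X x)

lemma weightedDiv_hessOpInv (hψ : ContDiff ℝ ∞ ψ) {x : E} (hx : IsUnit (hessOp ψ x))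
    {S : E → E} (hS : DifferentiableAt ℝ S x) :
    weightedDiv ψ φ (fun y => hessOpInv ψ y (S y)) x =
      traceCLM (hessOpInv ψ x * fderiv ℝ S x) - fderiv ℝ φ x (hessOpInv ψ x (S x)) := by
  rw [weightedDiv, divergence, (hasFDerivAt_hessOpInv_apply hψ hx hS.hasFDerivAt).fderiv,
    fderiv_logDetHess hψ hx, mul_sub, map_sub]
  ring

lemma weightedDiv_two_smul_add {X Y : E → E} {x : E} (hX : DifferentiableAt ℝ X x)
    (hY : DifferentiableAt ℝ Y x) :
    weightedDiv ψ φ (fun y => (2 : ℝ) • X y + Y y) x =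
      2 * weightedDiv ψ φ X x + weightedDiv ψ φ Y x := by
  have hadd := ((hX.hasFDerivAt.const_smul (2 : ℝ)).add hY.hasFDerivAt).fderiv
  simp only [weightedDiv, divergence, map_add, map_smul, smul_eq_mul]
  rw [show fderiv ℝ (fun y => (2 : ℝ) • X y + Y y) x = _ from hadd, map_add, map_smul, smul_eq_mul]
  ring

lemma weightedDiv_fderiv_apply_self (hψ : ContDiff ℝ ∞ ψ) (hg : ∀ x, IsUnit (hessOp ψ x))
    (hφ : ContDiff ℝ 2 φ) {X : E → E} (hX : ContDiff ℝ 2 X) (x : E) :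
    weightedDiv ψ φ (fun y => fderiv ℝ X y (X y)) x =
      fderiv ℝ (weightedDiv ψ φ X) x (X x) + traceCLM (fderiv ℝ X x * fderiv ℝ X x) +
        fderiv ℝ (fderiv ℝ φ) x (X x) (X x) -
        fderiv ℝ (fderiv ℝ (logDetHess ψ)) x (X x) (X x) := by
  have hXx := (hX.differentiable (by simp) x).hasFDerivAt
  have hdiv := (hasFDerivAt_divergence hX x).differentiableAt.hasFDerivAt
  have hlog := (hasFDerivAt_fderiv
    ((contDiff_logDetHess hψ hg).of_le ENat.LEInfty.out) x).clm_apply hXx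
  have hdφ := (hasFDerivAt_fderiv hφ x).clm_apply hXx
  have hL : HasFDerivAt (weightedDiv ψ φ X) _ x := (hdiv.add hlog).sub hdφ
  rw [hL.fderiv, weightedDiv, divergence_fderiv_apply_self hX]
  simp only [add_apply, sub_apply, ContinuousLinearMap.comp_apply, ContinuousLinearMap.flip_apply]
  ring

lemma weightedDiv_hessOpInv_fderiv_hessOp (hψ : ContDiff ℝ ∞ ψ) {x : E}
    (hx : IsUnit (hessOp ψ x)) {V : E → E} (hV : DifferentiableAt ℝ V x) :
    weightedDiv ψ φ (fun y => hessOpInv ψ y (fderiv ℝ (hessOp ψ) y (V y) (V y))) x =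
      traceCLM (hessOpInv ψ x * fderiv ℝ (fderiv ℝ (hessOp ψ)) x (V x) (V x)) +
        2 * traceCLM (hessOpInv ψ x * fderiv ℝ (hessOp ψ) x (V x) * fderiv ℝ V x) -
        fderiv ℝ φ x (hessOpInv ψ x (fderiv ℝ (hessOp ψ) x (V x) (V x))) := by
  have hdT := hasFDerivAt_fderiv ((contDiff_hessOp hψ).of_le ENat.LEInfty.out) x
  have hS := (hdT.clm_apply hV.hasFDerivAt).clm_apply hV.hasFDerivAt
  have hS' : fderiv ℝ (fun y => fderiv ℝ (hessOp ψ) y (V y) (V y)) x =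
      fderiv ℝ (fderiv ℝ (hessOp ψ)) x (V x) (V x) +
        (2 : ℝ) • (fderiv ℝ (hessOp ψ) x (V x) * fderiv ℝ V x) := by
    rw [hS.fderiv]
    ext v
    simp only [add_apply, ContinuousLinearMap.comp_apply, ContinuousLinearMap.flip_apply,
      smul_apply, mul_apply_eq_comp, fderiv_hessOp_comm hψ x (fderiv ℝ V x v),
      fderiv_fderiv_hessOp_swap hψ x v, fderiv_fderiv_hessOp_comm hψ x (V x) v]
    module
  rw [weightedDiv_hessOpInv hψ hx hS.differentiableAt, hS', mul_add, map_add, mul_smul_comm,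
    map_smul, smul_eq_mul, mul_assoc]

/-- The quadratic form of the matrix in condition (⋆). -/
noncomputable def starForm (ψ φ : E → ℝ) (x v : E) : ℝ :=
  fderiv ℝ (fderiv ℝ φ) x v v
    - (1 / 2) * fderiv ℝ φ x (hessOpInv ψ x (fderiv ℝ (hessOp ψ) x v v))
    - (1 / 2) * fderiv ℝ (fderiv ℝ (logDetHess ψ)) x v v

/-- The quadratic form `V ↦ Q*_{ψ,∇ψ(x)}(V)`. -/
noncomputable def cubicForm (ψ : E → ℝ) (x v : E) : ℝ :=
  traceCLM (hessOpInv ψ x * fderiv ℝ (hessOp ψ) x v * (hessOpInv ψ x * fderiv ℝ (hessOp ψ) x v))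

theorem bochner_formula (hψ : ContDiff ℝ ∞ ψ) (hg : ∀ x, IsUnit (hessOp ψ x))
    (hφ : ContDiff ℝ 2 φ) (hu : ContDiff ℝ ∞ u) (x : E) :
    weightedDiv ψ φ (rgrad ψ fun y => fderiv ℝ u y (rgrad ψ u y)) x -
        2 * fderiv ℝ (weightedDiv ψ φ (rgrad ψ u)) x (rgrad ψ u x) =
      2 * starForm ψ φ x (rgrad ψ u x) + (1 / 2) * cubicForm ψ x (rgrad ψ u x) +
        2 * traceCLM (hessOpInv ψ x * rhess ψ u x * (hessOpInv ψ x * rhess ψ u x)) := by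
  set V := rgrad ψ u
  have hVs : ContDiff ℝ ∞ V := contDiff_rgrad hψ hg hu
  have hdT := hasFDerivAt_fderiv ((contDiff_hessOp hψ).of_le ENat.LEInfty.out) x
  have hVx := hVs.differentiable (by simp) x
  have hDV := (hasFDerivAt_fderiv (hVs.of_le ENat.LEInfty.out) x).clm_apply hVx.hasFDerivAt
  have hY := hasFDerivAt_hessOpInv_apply hψ (hg x)
    ((hdT.clm_apply hVx.hasFDerivAt).clm_apply hVx.hasFDerivAt)
  have hw : rgrad ψ (fun y => fderiv ℝ u y (V y)) = fun y => (2 : ℝ) • fderiv ℝ V y (V y) +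
      hessOpInv ψ y (fderiv ℝ (hessOp ψ) y (V y) (V y)) :=
    funext fun y => rgrad_fderiv_rgrad hψ (hg y) hu
  rw [hw, weightedDiv_two_smul_add hDV.differentiableAt hY.differentiableAt,
    weightedDiv_fderiv_apply_self hψ hg hφ (hVs.of_le ENat.LEInfty.out),
    weightedDiv_hessOpInv_fderiv_hessOp hψ (hg x) hVx, starForm, cubicForm, rhess,
    fderiv_fderiv_logDetHess hψ hg, (hasFDerivAt_rgrad hψ (hg x) hu).fderiv]
  set B := hessOpInv ψ x * hessOp u x with hB
  set C := hessOpInv ψ x * fderiv ℝ (hessOp ψ) x (V x)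
  have hcomm := traceCLM_mul_comm B C
  simp only [mul_sub, sub_mul, mul_smul_comm, smul_mul_assoc, map_sub, map_smul, smul_eq_mul, ← hB]
  linarith

end BochnerFormula

section Convexity

variable {E : Type*} [NormedAddCommGroup E] [InnerProductSpace ℝ E]

lemma hasDerivAt_comp_line {f : E → ℝ} (hf : Differentiable ℝ f) (x v : E) (t : ℝ) :
    HasDerivAt (fun s : ℝ => f (x + s • v)) (fderiv ℝ f (x + t • v) v) t := by
  have hline : HasDerivAt (fun s : ℝ => x + s • v) v t := by
    simpa using ((hasDerivAt_id t).smul_const v).const_add x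
  exact (hf (x + t • v)).hasFDerivAt.comp_hasDerivAt t hline

lemma convexOn_comp_line {f : E → ℝ} (hf : ConvexOn ℝ univ f) (x v : E) :
    ConvexOn ℝ univ fun s : ℝ => f (x + s • v) :=
  (hf.comp_affineMap (AffineMap.lineMap x (x + v))).congr fun s _ => by
    simp [AffineMap.lineMap_apply, add_comm]

variable [CompleteSpace E] {ψ : E → ℝ}

lemma isPositive_hessOp (hψ : ContDiff ℝ ∞ ψ) (hconv : ConvexOn ℝ univ ψ) (x : E) :
    (hessOp ψ x).IsPositive := by
  refine (ContinuousLinearMap.isPositive_iff _).2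
    ⟨(isSelfAdjoint_hessOp hψ x).isSymmetric, fun v => ?_⟩
  have hd := hasDerivAt_comp_line (hψ.differentiable (by simp)) x v
  have hdd : HasFDerivAt (fun y => fderiv ℝ ψ y v) _ x :=
    (hasFDerivAt_fderiv (hψ.of_le ENat.LEInfty.out) x).clm_apply (hasFDerivAt_const v x)
  have hline : HasDerivAt (fun t : ℝ => x + t • v) v 0 := by
    simpa using ((hasDerivAt_id (0 : ℝ)).smul_const v).const_add x
  have hmono := ((convexOn_comp_line hconv x v).monotoneOn_deriv
    fun t _ => (hd t).differentiableAt).derivWithin_nonneg (x := 0)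
  have hderiv : deriv (fun t : ℝ => fderiv ℝ ψ (x + t • v) v) 0 = _ :=
    (hdd.comp_hasDerivAt_of_eq (0 : ℝ) hline (by simp)).deriv
  rw [derivWithin_univ, funext fun t => (hd t).deriv, hderiv] at hmono
  simpa [inner_hessOp_apply hψ] using hmono

lemma isPositive_hessOpInv (hψ : ContDiff ℝ ∞ ψ) (hconv : ConvexOn ℝ univ ψ) {x : E}
    (hx : IsUnit (hessOp ψ x)) : (hessOpInv ψ x).IsPositive := by
  refine (ContinuousLinearMap.isPositive_iff _).2
    ⟨(isSelfAdjoint_hessOpInv hψ x).isSymmetric, fun v => ?_⟩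
  have := (isPositive_hessOp hψ hconv x).inner_nonneg_right (hessOpInv ψ x v)
  rwa [hessOp_hessOpInv hx] at this

end Convexity

section Positivity

variable {E : Type*} [NormedAddCommGroup E] [InnerProductSpace ℝ E] [FiniteDimensional ℝ E]
  {ψ φ u : E → ℝ}

lemma traceCLM_mul_nonneg {A P : E →L[ℝ] E} (hA : A.IsPositive)
    (hP : P.IsPositive) : 0 ≤ traceCLM (P * A) := by
  let b := hA.isSymmetric.eigenvectorBasis rfl
  have hAb (i) : A (b i) = hA.isSymmetric.eigenvalues rfl i • b i :=
    hA.isSymmetric.apply_eigenvectorBasis rfl i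
  rw [traceCLM_apply, LinearMap.trace_eq_sum_inner _ b]
  refine Finset.sum_nonneg fun i _ => ?_
  have := hA.toLinearMap.nonneg_eigenvalues rfl i
  rw [ContinuousLinearMap.coe_coe, mul_apply_eq_comp, hAb, map_smul, inner_smul_right]
  exact mul_nonneg this (hP.inner_nonneg_right (b i))

lemma traceCLM_mul_sq_nonneg {A B : E →L[ℝ] E}
    (hA : A.IsPositive) (hB : IsSelfAdjoint B) : 0 ≤ traceCLM (A * B * (A * B)) := by
  have hBAB : (B * (A * B)).IsPositive := by
    have := hA.conj_adjoint B
    rwa [ContinuousLinearMap.isSelfAdjoint_iff'.1 hB] at this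
  rw [mul_assoc, traceCLM_mul_comm]
  exact traceCLM_mul_nonneg hA hBAB

lemma cubicForm_nonneg (hψ : ContDiff ℝ ∞ ψ) (hconv : ConvexOn ℝ univ ψ)
    {x : E} (hx : IsUnit (hessOp ψ x)) (v : E) : 0 ≤ cubicForm ψ x v :=
  traceCLM_mul_sq_nonneg (A := hessOpInv ψ x) (isPositive_hessOpInv hψ hconv hx)
    (isSelfAdjoint_fderiv_hessOp hψ x v)

lemma cubicForm_le (hψ : ContDiff ℝ ∞ ψ)
    (hconv : ConvexOn ℝ univ ψ) (hg : ∀ x, IsUnit (hessOp ψ x)) (hφ : ContDiff ℝ 2 φ)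
    (hstar : ∀ x v, 0 ≤ starForm ψ φ x v) (hu : ContDiff ℝ ∞ u) (x : E) :
    cubicForm ψ x (rgrad ψ u x) ≤
      2 * weightedDiv ψ φ (rgrad ψ fun y => fderiv ℝ u y (rgrad ψ u y)) x -
        4 * fderiv ℝ (weightedDiv ψ φ (rgrad ψ u)) x (rgrad ψ u x) := by
  have htrace : 0 ≤ traceCLM (hessOpInv ψ x * rhess ψ u x * (hessOpInv ψ x * rhess ψ u x)) :=
    traceCLM_mul_sq_nonneg (isPositive_hessOpInv hψ hconv (hg x)) (isSelfAdjoint_rhess hψ hu x)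
  linarith [bochner_formula hψ hg hφ hu x, hstar x (rgrad ψ u x)]

end Positivity

section Coordinates

variable {ι : Type*} [Fintype ι] [DecidableEq ι]

lemma toEuclideanCLM_eq_iff {M : Matrix ι ι ℝ} {A : EuclideanSpace ℝ ι →L[ℝ] EuclideanSpace ℝ ι} :
    Matrix.toEuclideanCLM (𝕜 := ℝ) M = A ↔
      ∀ i j, M i j = inner ℝ (EuclideanSpace.single i 1) (A (EuclideanSpace.single j 1)) := by
  refine ⟨fun h i j => by simp [← h, Matrix.inner_toEuclideanCLM], fun h => ?_⟩
  rw [← (Matrix.toEuclideanCLM (n := ι) (𝕜 := ℝ)).apply_symm_apply A]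
  congr 1
  ext i j
  rw [h, ← (Matrix.toEuclideanCLM (n := ι) (𝕜 := ℝ)).apply_symm_apply A,
    Matrix.inner_toEuclideanCLM]
  simp

lemma traceCLM_toEuclideanCLM (M : Matrix ι ι ℝ) :
    traceCLM (Matrix.toEuclideanCLM (𝕜 := ℝ) M) = M.trace := by
  rw [traceCLM_apply, Matrix.coe_toEuclideanCLM_eq_toEuclideanLin, Matrix.toEuclideanLin,
    Matrix.toLpLin_eq_toLin, Matrix.trace_toLin_eq]

lemma det_toEuclideanCLM (M : Matrix ι ι ℝ) :
    (Matrix.toEuclideanCLM (𝕜 := ℝ) M).det = M.det := by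
  rw [ContinuousLinearMap.det, Matrix.coe_toEuclideanCLM_eq_toEuclideanLin,
    Matrix.toEuclideanLin, Matrix.toLpLin_eq_toLin, LinearMap.det_toLin]

lemma sum_smul_single (v : EuclideanSpace ℝ ι) :
    ∑ i, v i • EuclideanSpace.single i (1 : ℝ) = v := by
  simpa using (EuclideanSpace.basisFun ι ℝ).sum_repr v

lemma sum_smul_apply_single {F : Type*} [AddCommGroup F] [Module ℝ F]
    [TopologicalSpace F] (L : EuclideanSpace ℝ ι →L[ℝ] F) (v : EuclideanSpace ℝ ι) :
    ∑ i, v i • L (EuclideanSpace.single i 1) = L v := by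
  conv_rhs => rw [← sum_smul_single v]
  simp only [map_sum, map_smul]

lemma sum_sum_mul_apply_single
    (L : EuclideanSpace ℝ ι →L[ℝ] EuclideanSpace ℝ ι →L[ℝ] ℝ)
    (v w : EuclideanSpace ℝ ι) :
    ∑ i, ∑ j, v i * w j * L (EuclideanSpace.single i 1) (EuclideanSpace.single j 1) = L v w := by
  rw [← sum_smul_apply_single L v]
  simp [← sum_smul_apply_single (L _) w, Finset.mul_sum, mul_assoc]

variable {n : ℕ} {ψ φ u : EuclideanSpace ℝ (Fin n) → ℝ}

lemma hess_apply (hu : ContDiff ℝ ∞ u) (x : EuclideanSpace ℝ (Fin n)) (i j : Fin n) :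
    hess u x i j =
      inner ℝ (hessOp u x (EuclideanSpace.single i 1)) (EuclideanSpace.single j 1) := by
  have hd : HasFDerivAt (pd i u) _ x :=
    (hasFDerivAt_fderiv (hu.of_le ENat.LEInfty.out) x).clm_apply (hasFDerivAt_const _ x)
  rw [inner_hessOp_comm hu, real_inner_comm, inner_hessOp_apply hu, hess,
    Matrix.of_apply, pd, hd.fderiv]
  simp

lemma third_apply (hψ : ContDiff ℝ ∞ ψ) (x : EuclideanSpace ℝ (Fin n)) (i j k : Fin n) :
    third ψ x i j k = inner ℝ (fderiv ℝ (hessOp ψ) x (EuclideanSpace.single i 1)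
      (EuclideanSpace.single j 1)) (EuclideanSpace.single k 1) := by
  have hd : HasFDerivAt (fun y => inner ℝ (hessOp ψ y (EuclideanSpace.single i 1))
      (EuclideanSpace.single j 1)) _ x :=
    ((hasFDerivAt_hessOp hψ x).clm_apply (hasFDerivAt_const _ x)).inner ℝ (hasFDerivAt_const _ x)
  have hess_eq : pd j (pd i ψ) = fun y => inner ℝ (hessOp ψ y (EuclideanSpace.single i 1))
      (EuclideanSpace.single j 1) := funext fun y => hess_apply hψ y i j
  rw [third, hess_eq, pd, hd.fderiv]
  have hsymm := (isSelfAdjoint_fderiv_hessOp hψ x (EuclideanSpace.single i 1)).isSymmetric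
    (EuclideanSpace.single k 1) (EuclideanSpace.single j 1)
  simp only [ContinuousLinearMap.coe_coe] at hsymm
  rw [real_inner_comm, ← hsymm]
  simp [fderiv_hessOp_comm hψ x (EuclideanSpace.single k 1)]

lemma toEuclideanCLM_hess (hu : ContDiff ℝ ∞ u) (x : EuclideanSpace ℝ (Fin n)) :
    Matrix.toEuclideanCLM (𝕜 := ℝ) (hess u x) = hessOp u x :=
  toEuclideanCLM_eq_iff.2 fun i j => by rw [hess_apply hu, inner_hessOp_comm hu]

lemma det_hessOp (hψ : ContDiff ℝ ∞ ψ) (x : EuclideanSpace ℝ (Fin n)) :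
    (hessOp ψ x).det = rho ψ x := by
  rw [← toEuclideanCLM_hess hψ, det_toEuclideanCLM, rho]

lemma isUnit_hessOp_iff (hψ : ContDiff ℝ ∞ ψ) {x : EuclideanSpace ℝ (Fin n)} :
    IsUnit (hessOp ψ x) ↔ (hess ψ x).det ≠ 0 := by
  rw [← toEuclideanCLM_hess hψ, MulEquiv.isUnit_map, Matrix.isUnit_iff_isUnit_det,
    isUnit_iff_ne_zero]

lemma toEuclideanCLM_hessInv (hψ : ContDiff ℝ ∞ ψ) {x : EuclideanSpace ℝ (Fin n)}
    (hx : IsUnit (hessOp ψ x)) :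
    Matrix.toEuclideanCLM (𝕜 := ℝ) (hessInv ψ x) = hessOpInv ψ x := by
  refine left_inv_eq_right_inv (a := hessOp ψ x) ?_ (Ring.mul_inverse_cancel _ hx)
  rw [← toEuclideanCLM_hess hψ, ← map_mul, hessInv,
    Matrix.nonsing_inv_mul _ ((isUnit_hessOp_iff hψ).1 hx).isUnit, map_one]

lemma logDetHess_eq (hψ : ContDiff ℝ ∞ ψ) : logDetHess ψ = fun x => Real.log (rho ψ x) :=
  funext fun x => by rw [logDetHess, det_hessOp hψ]

lemma sum_sum_mul_mul (M : Matrix ι ι ℝ) (v w : EuclideanSpace ℝ ι) :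
    ∑ i, ∑ j, M i j * v i * w j = inner ℝ v (Matrix.toEuclideanCLM (𝕜 := ℝ) M w) := by
  simp only [Matrix.inner_toEuclideanCLM, dotProduct, Matrix.mulVec, Finset.mul_sum]
  exact Finset.sum_congr rfl fun i _ => Finset.sum_congr rfl fun j _ => by ring

lemma gradient_apply (f : EuclideanSpace ℝ (Fin n) → ℝ) (x : EuclideanSpace ℝ (Fin n))
    (i : Fin n) : gradient f x i = pd i f x := by
  rw [pd, ← inner_gradient_left, EuclideanSpace.inner_single_right]
  simp

lemma gradInner_eq_fderiv (hψ : ContDiff ℝ ∞ ψ) {x : EuclideanSpace ℝ (Fin n)}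
    (hx : IsUnit (hessOp ψ x)) (u h : EuclideanSpace ℝ (Fin n) → ℝ) :
    gradInner ψ u h x = fderiv ℝ h x (rgrad ψ u x) := by
  simp only [gradInner, ← gradient_apply]
  rw [sum_sum_mul_mul, toEuclideanCLM_hessInv hψ hx, ← inner_hessOpInv_comm hψ, real_inner_comm,
    inner_gradient_left, rgrad]

lemma lap_eq_weightedDiv (hψ : ContDiff ℝ ∞ ψ) {x : EuclideanSpace ℝ (Fin n)}
    (hx : IsUnit (hessOp ψ x)) (hu : ContDiff ℝ ∞ u) :
    lap ψ φ u x = weightedDiv ψ φ (rgrad ψ u) x := by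
  have htrace : ∑ i, ∑ j, hessInv ψ x i j * hess u x i j =
      traceCLM (hessOpInv ψ x * hessOp u x) := by
    rw [← toEuclideanCLM_hessInv hψ hx, ← toEuclideanCLM_hess hu, ← map_mul,
      traceCLM_toEuclideanCLM, Matrix.trace]
    simp only [Matrix.diag_apply, Matrix.mul_apply]
    exact Finset.sum_congr rfl fun i _ => Finset.sum_congr rfl fun j _ => by
      rw [hess_apply hu, hess_apply hu, inner_hessOp_comm hu, real_inner_comm]
  rw [show rgrad ψ u = fun y => hessOpInv ψ y (gradient u y) from rfl, weightedDiv_hessOpInv hψ hx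
    (hasFDerivAt_gradient hu x).differentiableAt, lap, htrace]
  exact congrArg _ (gradInner_eq_fderiv hψ hx u φ)

lemma StarCondition.starForm_nonneg (hstar : StarCondition ψ φ) (hψ : ContDiff ℝ ∞ ψ)
    (hg : ∀ x, IsUnit (hessOp ψ x)) (hφ : ContDiff ℝ ∞ φ) (x v : EuclideanSpace ℝ (Fin n)) :
    0 ≤ starForm ψ φ x v := by
  have hchris (i l : Fin n) : ∑ k, (∑ m, hessInv ψ x k m * third ψ x i l m) * pd k φ x =
      fderiv ℝ φ x (hessOpInv ψ x (fderiv ℝ (hessOp ψ) x (EuclideanSpace.single i 1)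
        (EuclideanSpace.single l 1))) := by
    have h := sum_sum_mul_mul (hessInv ψ x) (gradient φ x) (fderiv ℝ (hessOp ψ) x
      (EuclideanSpace.single i 1) (EuclideanSpace.single l 1))
    rw [toEuclideanCLM_hessInv hψ (hg x), inner_gradient_left] at h
    simp only [← h, Finset.sum_mul, third_apply hψ, gradient_apply,
      EuclideanSpace.inner_single_right]
    exact Finset.sum_congr rfl fun i _ => Finset.sum_congr rfl fun j _ => by
      simp only [Real.ringHom_apply, one_mul]
      ring
  have hcontract := sum_sum_mul_apply_single (ContinuousLinearMap.compL ℝ _ _ _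
    (fderiv ℝ φ x ∘L hessOpInv ψ x) ∘L fderiv ℝ (hessOp ψ) x) v v
  have hhess {f : EuclideanSpace ℝ (Fin n) → ℝ} (hf : ContDiff ℝ ∞ f) :
      ∑ i, ∑ l, v i * v l * hess f x i l = fderiv ℝ (fderiv ℝ f) x v v := by
    simp_rw [← sum_sum_mul_apply_single (fderiv ℝ (fderiv ℝ f) x) v v, hess_apply hf,
      inner_hessOp_apply hf]
  have hquad := (hstar x).dotProduct_mulVec_nonneg v.ofLp
  rw [star_trivial, ← logDetHess_eq hψ] at hquad
  simp only [hchris, dotProduct, Matrix.mulVec, Matrix.of_apply, Finset.mul_sum] at hquad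
  simp only [ContinuousLinearMap.comp_apply, ContinuousLinearMap.compL_apply] at hcontract
  rw [starForm, ← hcontract, ← hhess hφ, ← hhess (contDiff_logDetHess hψ hg)]
  simp only [Finset.mul_sum, ← Finset.sum_sub_distrib]
  exact hquad.trans_eq (Finset.sum_congr rfl fun i _ => Finset.sum_congr rfl fun l _ => by ring)

lemma QStar_gradient (hψ : ContDiff ℝ ∞ ψ) {y : EuclideanSpace ℝ (Fin n)}
    (hy : IsUnit (hessOp ψ y)) (hleg : gradient (legendre ψ) (gradient ψ y) = y)
    (V : EuclideanSpace ℝ (Fin n)) :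
    QStar ψ (gradient ψ y) V = cubicForm ψ y V := by
  let S (i : Fin n) : Matrix (Fin n) (Fin n) ℝ := Matrix.of fun m k => third ψ y i k m
  have hS : Matrix.toEuclideanCLM (𝕜 := ℝ) (∑ i, V i • S i) = fderiv ℝ (hessOp ψ) y V := by
    have hSi (i : Fin n) : Matrix.toEuclideanCLM (𝕜 := ℝ) (S i) =
        fderiv ℝ (hessOp ψ) y (EuclideanSpace.single i 1) :=
      toEuclideanCLM_eq_iff.2 fun m k => by
        simp only [S, Matrix.of_apply, third_apply hψ, real_inner_comm]
    simp only [map_sum, map_smul, hSi, sum_smul_apply_single]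
  have htrace (i j : Fin n) : (hessInv ψ y * S j * (hessInv ψ y * S i)).trace =
      ∑ k, ∑ l, ∑ m, ∑ p, hessInv ψ y l m * third ψ y j k m * hessInv ψ y k p *
        third ψ y i l p := by
    simp only [Matrix.trace, Matrix.diag_apply, Matrix.mul_apply, Finset.sum_mul_sum, S,
      Matrix.of_apply]
    simp only [← mul_assoc]
    exact Finset.sum_comm
  rw [cubicForm, ← hS, ← toEuclideanCLM_hessInv hψ hy, ← map_mul, ← map_mul,
    traceCLM_toEuclideanCLM, QStar, hleg]
  simp only [Finset.sum_mul, Finset.mul_sum, Matrix.trace_sum, Matrix.mul_smul, Matrix.smul_mul,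
    Matrix.trace_smul, smul_eq_mul, htrace]
  simp only [← mul_assoc]

end Coordinates

section GradientMap

variable {E : Type*} [NormedAddCommGroup E] [InnerProductSpace ℝ E] [CompleteSpace E] {ψ : E → ℝ}

lemma tangent_le (hψ : Differentiable ℝ ψ) (hconv : ConvexOn ℝ univ ψ) (y z : E) :
    ψ y + inner ℝ (gradient ψ y) (z - y) ≤ ψ z := by
  have h := (convexOn_comp_line hconv y (z - y)).le_slope_of_hasDerivAt (mem_univ 0) (mem_univ 1)
    one_pos (hasDerivAt_comp_line hψ y (z - y) 0)
  simp only [slope_def_field, zero_smul, add_zero, one_smul, add_sub_cancel, sub_zero,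
    div_one] at h
  rw [inner_gradient_left]
  linarith

lemma inner_gradient_sub_le (hψ : Differentiable ℝ ψ) (hconv : ConvexOn ℝ univ ψ) (y z : E) :
    inner ℝ (gradient ψ y) z - ψ z ≤ inner ℝ (gradient ψ y) y - ψ y := by
  have h := tangent_le hψ hconv y z
  rw [inner_sub_right] at h
  linarith

lemma map_gradient_nhds (hψ : ContDiff ℝ ∞ ψ) {y : E} (hy : IsUnit (hessOp ψ y)) :
    map (gradient ψ) (𝓝 y) = 𝓝 (gradient ψ y) := by
  have hstrict : HasStrictFDerivAt (gradient ψ)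
      (ContinuousLinearEquiv.ofUnit hy.unit : E →L[ℝ] E) y :=
    (contDiff_gradient hψ).contDiffAt.hasStrictFDerivAt (by simp)
  exact hstrict.map_nhds_eq_of_equiv

lemma isOpen_range_gradient (hψ : ContDiff ℝ ∞ ψ) (hg : ∀ x, IsUnit (hessOp ψ x)) :
    IsOpen (range (gradient ψ)) :=
  (IsOpenMap.of_nhds_le fun x => (map_gradient_nhds hψ (hg x)).ge).isOpen_range

end GradientMap

section Legendre

variable {n : ℕ} {ψ : EuclideanSpace ℝ (Fin n) → ℝ}

lemma legendre_gradient (hψ : Differentiable ℝ ψ) (hconv : ConvexOn ℝ univ ψ)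
    (y : EuclideanSpace ℝ (Fin n)) :
    legendre ψ (gradient ψ y) = inner ℝ (gradient ψ y) y - ψ y :=
  le_antisymm (ciSup_le (inner_gradient_sub_le hψ hconv y))
    (le_ciSup (f := fun z => inner ℝ (gradient ψ y) z - ψ z)
      ⟨_, forall_mem_range.2 (inner_gradient_sub_le hψ hconv y)⟩ y)

lemma gradient_legendre (hψ : ContDiff ℝ ∞ ψ) (hconv : ConvexOn ℝ univ ψ)
    {y : EuclideanSpace ℝ (Fin n)} (hy : IsUnit (hessOp ψ y)) :
    gradient (legendre ψ) (gradient ψ y) = y := by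
  have hψd := hψ.differentiable (by simp)
  refine HasGradientAt.gradient (hasGradientAt_iff_isLittleO.2 ?_)
  rw [← map_gradient_nhds hψ hy, Asymptotics.isLittleO_map, Asymptotics.isLittleO_iff]
  intro c hc
  filter_upwards [Metric.closedBall_mem_nhds y hc] with z hz
  -- The remainder lies between `0` and `⟨∇ψ z - ∇ψ y, z - y⟩`.
  have hlower := inner_gradient_sub_le hψd hconv z y
  have hupper := inner_gradient_sub_le hψd hconv y z
  have hcs : inner ℝ (gradient ψ z - gradient ψ y) (z - y) ≤
      c * ‖gradient ψ z - gradient ψ y‖ := calc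
    _ ≤ ‖gradient ψ z - gradient ψ y‖ * ‖z - y‖ := real_inner_le_norm _ _
    _ ≤ ‖gradient ψ z - gradient ψ y‖ * c :=
      mul_le_mul_of_nonneg_left (mem_closedBall_iff_norm.1 hz) (norm_nonneg _)
    _ = _ := mul_comm _ _
  have hc0 : 0 ≤ c * ‖gradient ψ z - gradient ψ y‖ := by positivity
  simp only [inner_sub_left, inner_sub_right] at hcs
  rw [Function.comp_apply, Function.comp_apply, legendre_gradient hψd hconv,
    legendre_gradient hψd hconv, real_inner_comm _ y, inner_sub_left, Real.norm_eq_abs, abs_le]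
  constructor <;> linarith

lemma injective_gradient (hψ : ContDiff ℝ ∞ ψ) (hconv : ConvexOn ℝ univ ψ)
    (hg : ∀ x, IsUnit (hessOp ψ x)) : Function.Injective (gradient ψ) :=
  Function.LeftInverse.injective fun x => gradient_legendre hψ hconv (hg x)

end Legendre

section PushForward

variable {n : ℕ} {ψ φ : EuclideanSpace ℝ (Fin n) → ℝ}

lemma measurableEmbedding_gradient (hψ : ContDiff ℝ ∞ ψ) (hconv : ConvexOn ℝ univ ψ)
    (hg : ∀ x, IsUnit (hessOp ψ x)) : MeasurableEmbedding (gradient ψ) :=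
  (contDiff_gradient hψ).continuous.measurableEmbedding (injective_gradient hψ hconv hg)

lemma rho_pos (hψ : ContDiff ℝ ∞ ψ) (hconv : ConvexOn ℝ univ ψ)
    {x : EuclideanSpace ℝ (Fin n)} (hx : IsUnit (hessOp ψ x)) : 0 < rho ψ x := by
  refine lt_of_le_of_ne ?_ ((isUnit_hessOp_iff hψ).1 hx).symm
  have hpos : (Matrix.toEuclideanCLM (𝕜 := ℝ) (hess ψ x)).IsPositive :=
    toEuclideanCLM_hess hψ x ▸ isPositive_hessOp hψ hconv x
  rw [← ContinuousLinearMap.isPositive_toLinearMap_iff,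
    Matrix.coe_toEuclideanCLM_eq_toEuclideanLin, Matrix.isPositive_toEuclideanLin_iff] at hpos
  exact hpos.det_nonneg

lemma setLIntegral_rho (hψ : ContDiff ℝ ∞ ψ) (hconv : ConvexOn ℝ univ ψ)
    (hg : ∀ x, IsUnit (hessOp ψ x)) {s : Set (EuclideanSpace ℝ (Fin n))} (hs : MeasurableSet s) :
    ∫⁻ x in s, ENNReal.ofReal (rho ψ x) = volume (gradient ψ '' s) := by
  rw [← lintegral_abs_det_fderiv_eq_addHaar_image volume hs
    (fun x _ => (hasFDerivAt_gradient hψ x).hasFDerivWithinAt)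
    (injective_gradient hψ hconv hg).injOn]
  exact lintegral_congr fun x => by
    rw [det_hessOp hψ, abs_of_pos (rho_pos hψ hconv (hg x))]

lemma isFiniteMeasure_mu (hψ : ContDiff ℝ ∞ ψ) (hconv : ConvexOn ℝ univ ψ)
    (hg : ∀ x, IsUnit (hessOp ψ x)) (hφ : BddBelow (range φ))
    (hbdd : Bornology.IsBounded (range (gradient ψ))) : IsFiniteMeasure (mu ψ φ) := by
  obtain ⟨m, hm⟩ := hφ
  have hdensity (x : EuclideanSpace ℝ (Fin n)) :
      ENNReal.ofReal (Real.exp (-φ x) * rho ψ x) ≤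
        ENNReal.ofReal (Real.exp (-m)) * ENNReal.ofReal (rho ψ x) := by
    rw [← ENNReal.ofReal_mul (Real.exp_pos _).le]
    exact ENNReal.ofReal_le_ofReal (mul_le_mul_of_nonneg_right
      (Real.exp_le_exp.2 (neg_le_neg (hm (mem_range_self x)))) (rho_pos hψ hconv (hg x)).le)
  refine ⟨?_⟩
  rw [mu, withDensity_apply _ MeasurableSet.univ]
  refine (lintegral_mono hdensity).trans_lt ?_
  rw [lintegral_const_mul' _ _ ENNReal.ofReal_ne_top, setLIntegral_rho hψ hconv hg .univ,
    image_univ]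
  exact ENNReal.mul_lt_top ENNReal.ofReal_lt_top hbdd.measure_lt_top

lemma nu_absolutelyContinuous (hψ : ContDiff ℝ ∞ ψ) (hconv : ConvexOn ℝ univ ψ)
    (hg : ∀ x, IsUnit (hessOp ψ x)) : nu ψ φ ≪ volume := by
  refine Measure.AbsolutelyContinuous.mk fun s hs hs0 => ?_
  have hpre := (contDiff_gradient hψ).continuous.measurable hs
  have hrho : Measurable (rho ψ) := by
    simp only [funext fun x => (det_hessOp hψ x).symm]
    exact (contDiff_det.comp (contDiff_hessOp hψ)).continuous.measurable
  have hzero := setLIntegral_rho hψ hconv hg hpre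
  rw [measure_mono_null (image_preimage_subset _ _) hs0, ← withDensity_apply _ hpre,
    withDensity_apply_eq_zero' hrho.ennreal_ofReal.aemeasurable] at hzero
  rw [nu, Measure.map_apply (contDiff_gradient hψ).continuous.measurable hs]
  have hsub : gradient ψ ⁻¹' s ⊆ {x | ENNReal.ofReal (rho ψ x) ≠ 0} ∩ gradient ψ ⁻¹' s :=
    subset_inter (fun x _ => (ENNReal.ofReal_pos.2 (rho_pos hψ hconv (hg x))).ne') subset_rfl
  exact withDensity_absolutelyContinuous _ _ (measure_mono_null hsub hzero)

lemma nu_compl_range (hψ : ContDiff ℝ ∞ ψ) (hg : ∀ x, IsUnit (hessOp ψ x)) :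
    nu ψ φ (range (gradient ψ))ᶜ = 0 := by
  rw [nu, Measure.map_apply (contDiff_gradient hψ).continuous.measurable
    (isOpen_range_gradient hψ hg).measurableSet.compl, preimage_compl, preimage_range, compl_univ,
    measure_empty]

end PushForward

section SquareIntegrable

variable {α : Type*} [MeasurableSpace α] {μ : Measure α} {f g h : α → ℝ}

lemma ofReal_integral_le_lintegral (hf : Integrable f μ) :
    ENNReal.ofReal (∫ x, f x ∂μ) ≤ ∫⁻ x, ENNReal.ofReal (f x) ∂μ := by
  rw [integral_eq_lintegral_pos_part_sub_lintegral_neg_part hf]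
  exact (ENNReal.ofReal_le_ofReal (sub_le_self _ ENNReal.toReal_nonneg)).trans
    ENNReal.ofReal_toReal_le

lemma integral_sq_le_of_eLpNorm_lt (hf : MemLp f 2 μ) {δ : ℝ}
    (hlt : eLpNorm f 2 μ < ENNReal.ofReal √δ) : ∫ x, f x ^ 2 ∂μ ≤ δ := by
  rw [hf.eLpNorm_eq_integral_rpow_norm (by simp) (by simp)] at hlt
  simp only [ENNReal.toReal_ofNat, Real.rpow_ofNat, Real.norm_eq_abs, sq_abs, ← one_div,
    ← Real.sqrt_eq_rpow] at hlt
  exact ((Real.sqrt_lt_sqrt_iff (integral_nonneg fun _ => sq_nonneg _)).1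
    (ENNReal.ofReal_lt_ofReal_iff'.1 hlt).1).le

lemma integral_sub_neg_half_mul_sq (hg : MemLp g 2 μ) (hh : MemLp h 2 μ) :
    4 * ∫ x, (g x - (-1 / 2) * h x) ^ 2 ∂μ =
      ∫ x, h x ^ 2 ∂μ - (-4 * (∫ x, h x * g x ∂μ) - 4 * ∫ x, g x ^ 2 ∂μ) := by
  have hgh : Integrable (fun x => h x * g x) μ := hh.integrable_mul hg
  have hexp (x : α) : (g x - (-1 / 2) * h x) ^ 2 = g x ^ 2 + h x * g x + 1 / 4 * h x ^ 2 := by ring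
  simp only [hexp]
  have hsum : Integrable (fun x => g x ^ 2 + h x * g x) μ := hg.integrable_sq.add hgh
  rw [integral_add hsum (hh.integrable_sq.const_mul _), integral_add hg.integrable_sq hgh,
    integral_const_mul]
  ring

lemma ofReal_integral_sq_le_of_dense {C : ℝ≥0∞} {S : Set (α → ℝ)} (hh : MemLp h 2 μ)
    (hS : ∀ g ∈ S, MemLp g 2 μ)
    (hdense : ∀ ε : ℝ≥0∞, 0 < ε → ∃ g ∈ S, eLpNorm (fun x => g x - (-1 / 2) * h x) 2 μ < ε)
    (hC : ∀ g ∈ S, ENNReal.ofReal (-4 * (∫ x, h x * g x ∂μ) - 4 * ∫ x, g x ^ 2 ∂μ) ≤ C) :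
    ENNReal.ofReal (∫ x, h x ^ 2 ∂μ) ≤ C := by
  refine ENNReal.le_of_forall_pos_le_add fun δ hδ _ => ?_
  obtain ⟨g, hgS, hgh⟩ := hdense (ENNReal.ofReal √(δ / 4))
    (ENNReal.ofReal_pos.2 (Real.sqrt_pos.2 (by positivity)))
  have herr : ∫ x, (g x - (-1 / 2) * h x) ^ 2 ∂μ ≤ (δ : ℝ) / 4 :=
    integral_sq_le_of_eLpNorm_lt ((hS g hgS).sub (hh.const_mul _)) hgh
  have hexp := integral_sub_neg_half_mul_sq (hS g hgS) hh
  calc ENNReal.ofReal (∫ x, h x ^ 2 ∂μ)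
      ≤ ENNReal.ofReal ((-4 * (∫ x, h x * g x ∂μ) - 4 * ∫ x, g x ^ 2 ∂μ) + δ) :=
        ENNReal.ofReal_le_ofReal (by linarith)
    _ ≤ ENNReal.ofReal (-4 * (∫ x, h x * g x ∂μ) - 4 * ∫ x, g x ^ 2 ∂μ) + ENNReal.ofReal δ :=
        ENNReal.ofReal_add_le
    _ ≤ C + δ := add_le_add (hC g hgS) ENNReal.ofReal_coe_nnreal.le

end SquareIntegrable

section IntegratedBochner

variable {n : ℕ} {ψ φ u : EuclideanSpace ℝ (Fin n) → ℝ}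

lemma cubicForm_rgrad_le (hψ : ContDiff ℝ ∞ ψ) (hconv : ConvexOn ℝ univ ψ)
    (hg : ∀ x, IsUnit (hessOp ψ x)) (hφ : ContDiff ℝ ∞ φ) (hstar : StarCondition ψ φ)
    (hu : ContDiff ℝ ∞ u) (x : EuclideanSpace ℝ (Fin n)) :
    cubicForm ψ x (rgrad ψ u x) ≤
      2 * lap ψ φ (gradInner ψ u u) x - 4 * gradInner ψ u (lap ψ φ u) x := by
  have hgrad : gradInner ψ u u = fun y => fderiv ℝ u y (rgrad ψ u y) :=
    funext fun y => gradInner_eq_fderiv hψ (hg y) u u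
  have hlap : lap ψ φ u = weightedDiv ψ φ (rgrad ψ u) :=
    funext fun y => lap_eq_weightedDiv hψ (hg y) hu
  rw [gradInner_eq_fderiv hψ (hg x), hlap, hgrad, lap_eq_weightedDiv hψ (hg x)
    ((hu.fderiv_right le_rfl).clm_apply (contDiff_rgrad hψ hg hu))]
  exact cubicForm_le hψ hconv hg (hφ.of_le ENat.LEInfty.out)
    (hstar.starForm_nonneg hψ hg hφ) hu x

lemma continuous_cubicForm_rgrad (hψ : ContDiff ℝ ∞ ψ) (hg : ∀ x, IsUnit (hessOp ψ x))
    (hu : ContDiff ℝ ∞ u) : Continuous fun x => cubicForm ψ x (rgrad ψ u x) := by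
  have hT : Continuous fun x => fderiv ℝ (hessOp ψ) x (rgrad ψ u x) :=
    ((contDiff_hessOp hψ).continuous_fderiv (by simp)).clm_apply
      (contDiff_rgrad hψ hg hu).continuous
  have hA := (contDiff_hessOpInv hψ hg).continuous.mul hT
  exact traceCLM.continuous.comp (hA.mul hA)

lemma integrable_cubicForm_rgrad_and_integral_le (hψ : ContDiff ℝ ∞ ψ) (hconv : ConvexOn ℝ univ ψ)
    (hg : ∀ x, IsUnit (hessOp ψ x)) (hφ : ContDiff ℝ ∞ φ) (hstar : StarCondition ψ φ)
    (hu : ContDiff ℝ ∞ u) (hone : IntegratesByParts ψ φ (gradInner ψ u u) fun _ => 1)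
    (hlap : IntegratesByParts ψ φ u (lap ψ φ u)) :
    Integrable (fun x => cubicForm ψ x (rgrad ψ u x)) (mu ψ φ) ∧
      ∫ x, cubicForm ψ x (rgrad ψ u x) ∂(mu ψ φ) ≤ 4 * ∫ x, lap ψ φ u x ^ 2 ∂(mu ψ φ) := by
  obtain ⟨hlapgrad, -, hlapgrad_integral⟩ := hone
  obtain ⟨-, hgradlap, hgradlap_integral⟩ := hlap
  have hgrad_one (x : EuclideanSpace ℝ (Fin n)) :
      gradInner ψ (gradInner ψ u u) (fun _ => 1) x = 0 := by
    simp [gradInner_eq_fderiv hψ (hg x)]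
  simp only [one_mul, hgrad_one, integral_zero, neg_zero] at hlapgrad hlapgrad_integral
  have hle := cubicForm_rgrad_le hψ hconv hg hφ hstar hu
  have hbound : Integrable (fun x => 2 * lap ψ φ (gradInner ψ u u) x -
      4 * gradInner ψ u (lap ψ φ u) x) (mu ψ φ) :=
    (hlapgrad.const_mul 2).sub (hgradlap.const_mul 4)
  have hint : Integrable (fun x => cubicForm ψ x (rgrad ψ u x)) (mu ψ φ) :=
    hbound.mono' (continuous_cubicForm_rgrad hψ hg hu).aestronglyMeasurable
      (ae_of_all _ fun x => by
        rw [Real.norm_of_nonneg (cubicForm_nonneg hψ hconv (hg x) _)]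
        exact hle x)
  refine ⟨hint, (integral_mono hint hbound hle).trans_eq ?_⟩
  rw [integral_sub (hlapgrad.const_mul 2) (hgradlap.const_mul 4), integral_const_mul,
    integral_const_mul, hlapgrad_integral]
  simp only [pow_two]
  linarith

end IntegratedBochner

section Duality

variable {n : ℕ} {ψ φ u f : EuclideanSpace ℝ (Fin n) → ℝ}

lemma exists_sq_mul_le_one_and_sub_le {a q : ℝ} (hq : 0 ≤ q) (ha : 0 < a) :
    ∃ t : ℝ, t ^ 2 * q ≤ 1 ∧ 4 * a - q ≤ 4 * (t * a) ^ 2 := by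
  rcases hq.eq_or_lt with rfl | hq
  · refine ⟨(√a)⁻¹, by simp, ?_⟩
    rw [mul_pow, inv_pow, Real.sq_sqrt ha.le, pow_two, inv_mul_cancel_left₀ ha.ne', sub_zero]
  · refine ⟨(√q)⁻¹, ?_, ?_⟩
    · rw [inv_pow, Real.sq_sqrt hq.le, inv_mul_cancel₀ hq.ne']
    · rw [mul_pow, inv_pow, Real.sq_sqrt hq.le, inv_mul_eq_div, mul_div_assoc', le_div_iff₀ hq]
      nlinarith only [sq_nonneg (2 * a - q)]

lemma cubicForm_smul {E : Type*} [NormedAddCommGroup E] [InnerProductSpace ℝ E]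
    [FiniteDimensional ℝ E] (ψ : E → ℝ) (x v : E) (t : ℝ) :
    cubicForm ψ x (t • v) = t ^ 2 * cubicForm ψ x v := by
  simp only [cubicForm, map_smul, mul_smul_comm, smul_mul_assoc, smul_eq_mul]
  ring

lemma ofReal_sub_cubicForm_le_Q (hψ : ContDiff ℝ ∞ ψ) (hconv : ConvexOn ℝ univ ψ)
    {y : EuclideanSpace ℝ (Fin n)} (hy : IsUnit (hessOp ψ y)) (U V : EuclideanSpace ℝ (Fin n)) :
    ENNReal.ofReal (4 * inner ℝ U (hessOp ψ y V) - cubicForm ψ y V) ≤ Q ψ (gradient ψ y) U := by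
  have hq := cubicForm_nonneg hψ hconv hy V
  rcases le_or_gt (inner ℝ U (hessOp ψ y V)) 0 with ha | ha
  · rw [ENNReal.ofReal_of_nonpos (by linarith)]
    exact zero_le
  obtain ⟨t, hQStar, hle⟩ := exists_sq_mul_le_one_and_sub_le hq ha
  have hleg := gradient_legendre hψ hconv hy
  rw [← cubicForm_smul, ← QStar_gradient hψ hy hleg] at hQStar
  refine (ENNReal.ofReal_le_ofReal hle).trans (le_trans (le_of_eq ?_) (le_iSup₂ (t • V) hQStar))
  rw [hleg, sum_sum_mul_mul, toEuclideanCLM_hess hψ, map_smul, inner_smul_right]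

lemma gradInner_comp_gradient (hψ : ContDiff ℝ ∞ ψ) {y : EuclideanSpace ℝ (Fin n)}
    (hy : IsUnit (hessOp ψ y)) (hf : DifferentiableAt ℝ f (gradient ψ y)) :
    gradInner ψ u (fun x => f (gradient ψ x)) y =
      inner ℝ (gradient f (gradient ψ y)) (hessOp ψ y (rgrad ψ u y)) := by
  have hchain : HasFDerivAt (fun x => f (gradient ψ x)) _ y :=
    hf.hasFDerivAt.comp y (hasFDerivAt_gradient hψ y)
  rw [gradInner_eq_fderiv hψ hy, hchain.fderiv, inner_gradient_left]
  rfl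

lemma ae_differentiableAt_gradient {C : ℝ≥0} (hψ : ContDiff ℝ ∞ ψ) (hconv : ConvexOn ℝ univ ψ)
    (hg : ∀ x, IsUnit (hessOp ψ x)) (hf : LipschitzOnWith C f (range (gradient ψ))) :
    ∀ᵐ y ∂(mu ψ φ), DifferentiableAt ℝ f (gradient ψ y) := by
  have hae : ∀ᵐ x ∂(nu ψ φ), x ∈ range (gradient ψ) →
      DifferentiableWithinAt ℝ f (range (gradient ψ)) x :=
    (nu_absolutelyContinuous hψ hconv hg).ae_le hf.ae_differentiableWithinAt_of_mem
  filter_upwards [ae_of_ae_map (contDiff_gradient hψ).continuous.aemeasurable hae] with y hy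
  exact (hy (mem_range_self y)).differentiableAt
    ((isOpen_range_gradient hψ hg).mem_nhds (mem_range_self y))

lemma ofReal_integral_le_lintegral_Q {C : ℝ≥0} (hψ : ContDiff ℝ ∞ ψ)
    (hconv : ConvexOn ℝ univ ψ) (hg : ∀ x, IsUnit (hessOp ψ x)) (hφ : ContDiff ℝ ∞ φ)
    (hstar : StarCondition ψ φ) (hf : LipschitzOnWith C f (range (gradient ψ)))
    (hu : ContDiff ℝ ∞ u) (hone : IntegratesByParts ψ φ (gradInner ψ u u) fun _ => 1)
    (hlap : IntegratesByParts ψ φ u (lap ψ φ u))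
    (hfu : IntegratesByParts ψ φ u fun x => f (gradient ψ x)) :
    ENNReal.ofReal (-4 * (∫ x, f (gradient ψ x) * lap ψ φ u x ∂(mu ψ φ)) -
        4 * ∫ x, lap ψ φ u x ^ 2 ∂(mu ψ φ)) ≤
      ∫⁻ x, Q ψ (gradient ψ x) (gradient f (gradient ψ x)) ∂(mu ψ φ) := by
  obtain ⟨hint, hbochner⟩ :=
    integrable_cubicForm_rgrad_and_integral_le hψ hconv hg hφ hstar hu hone hlap
  obtain ⟨-, hgrad, hgrad_integral⟩ := hfu
  have hdual : Integrable (fun x => 4 * gradInner ψ u (fun x => f (gradient ψ x)) x -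
      cubicForm ψ x (rgrad ψ u x)) (mu ψ φ) := (hgrad.const_mul 4).sub hint
  calc _ ≤ ENNReal.ofReal (∫ x, (4 * gradInner ψ u (fun x => f (gradient ψ x)) x -
          cubicForm ψ x (rgrad ψ u x)) ∂(mu ψ φ)) := by
        refine ENNReal.ofReal_le_ofReal ?_
        rw [integral_sub (hgrad.const_mul 4) hint, integral_const_mul, hgrad_integral]
        linarith
    _ ≤ ∫⁻ x, ENNReal.ofReal (4 * gradInner ψ u (fun x => f (gradient ψ x)) x -
          cubicForm ψ x (rgrad ψ u x)) ∂(mu ψ φ) := ofReal_integral_le_lintegral hdual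
    _ ≤ _ := by
        refine lintegral_mono_ae ?_
        filter_upwards [ae_differentiableAt_gradient hψ hconv hg hf] with y hy
        rw [gradInner_comp_gradient hψ (hg y) hy]
        exact ofReal_sub_cubicForm_le_Q hψ hconv (hg y) _ _

end Duality

section Poincare

lemma memLp_comp_of_lipschitzOnWith_range {α E : Type*} [TopologicalSpace α] [MeasurableSpace α]
    [OpensMeasurableSpace α] [SecondCountableTopology α] [PseudoMetricSpace E] {μ : Measure α}
    [IsFiniteMeasure μ] {p : ℝ≥0∞} {G : α → E} {f : E → ℝ} {C : ℝ≥0} (hG : Continuous G)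
    (hbdd : Bornology.IsBounded (range G)) (hf : LipschitzOnWith C f (range G)) :
    MemLp (fun x => f (G x)) p μ := by
  obtain ⟨g, hg, hfg⟩ := hf.extend_real
  have hcomp : (fun x => f (G x)) = g ∘ G := funext fun x => hfg (mem_range_self x)
  obtain ⟨R, hR⟩ := isBounded_iff_forall_norm_le.1 (hg.isBounded_image hbdd)
  rw [hcomp]
  exact MemLp.of_bound (hg.continuous.comp hG).aestronglyMeasurable R
    (ae_of_all _ fun x => hR _ (mem_image_of_mem g (mem_range_self x)))

variable {n : ℕ} {ψ φ f : EuclideanSpace ℝ (Fin n) → ℝ}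

lemma lintegral_sq_le_lintegral_Q {C : ℝ≥0} [IsFiniteMeasure (mu ψ φ)] (hψ : ContDiff ℝ ∞ ψ)
    (hconv : ConvexOn ℝ univ ψ) (hg : ∀ x, IsUnit (hessOp ψ x)) (hφ : ContDiff ℝ ∞ φ)
    (hstar : StarCondition ψ φ) (hreg : RegularAtInfinity (range (gradient ψ)) ψ φ)
    (hbdd : Bornology.IsBounded (range (gradient ψ)))
    (hf : LipschitzOnWith C f (range (gradient ψ)))
    (hmean : ∫ x, f (gradient ψ x) ∂(mu ψ φ) = 0) :
    ∫⁻ x, ENNReal.ofReal (f (gradient ψ x) ^ 2) ∂(mu ψ φ) ≤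
      ∫⁻ x, Q ψ (gradient ψ x) (gradient f (gradient ψ x)) ∂(mu ψ φ) := by
  obtain ⟨X, hsmooth, hparts, hparts_lipschitz, hconst, hlap, hgradInner, hdense⟩ := hreg
  have hmemLp : MemLp (fun x => f (gradient ψ x)) 2 (mu ψ φ) :=
    memLp_comp_of_lipschitzOnWith_range (contDiff_gradient hψ).continuous hbdd hf
  have hinv : EqOn (fun x => gradient ψ (gradient (legendre ψ) x)) id (range (gradient ψ)) := by
    rintro _ ⟨y, rfl⟩
    exact congrArg (gradient ψ) (gradient_legendre hψ hconv (hg y))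
  have hlipschitz : LipschitzOnWith C (fun x => f (gradient ψ (gradient (legendre ψ) x)))
      (range (gradient ψ)) := fun x hx y hy => by
    simpa only [hinv hx, hinv hy, id_eq] using hf hx hy
  rw [← ofReal_integral_eq_lintegral_ofReal hmemLp.integrable_sq (ae_of_all _ fun _ => sq_nonneg _)]
  refine ofReal_integral_sq_le_of_dense (S := lap ψ φ '' X) hmemLp ?_ ?_ ?_
  · rintro _ ⟨u, hu, rfl⟩
    refine (memLp_two_iff_integrable_sq
      (hsmooth _ (hlap u hu)).continuous.aestronglyMeasurable).2 ?_
    simpa only [pow_two] using (hparts u hu _ (hlap u hu)).1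
  · intro ε hε
    obtain ⟨u, hu, hlt⟩ := hdense (fun x => (-1 / 2) * f (gradient ψ x)) (hmemLp.const_mul _)
      (by rw [integral_const_mul, hmean, mul_zero]) ε hε
    exact ⟨_, mem_image_of_mem _ hu, hlt⟩
  · rintro _ ⟨u, hu, rfl⟩
    exact ofReal_integral_le_lintegral_Q hψ hconv hg hφ hstar hf (hsmooth u hu)
      (hparts _ (hgradInner u hu) _ (hconst 1)) (hparts u hu _ (hlap u hu))
      (hparts_lipschitz u hu _ ⟨C, hlipschitz⟩)

end Poincare

end ToricPoincare

theorem proposition3p6 {n : ℕ} (K : Set (EuclideanSpace ℝ (Fin n)))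
    (hKopen : IsOpen K) (hKbdd : Bornology.IsBounded K) (hKconv : Convex ℝ K)
    (ψ φ : EuclideanSpace ℝ (Fin n) → ℝ)
    (hψ : ContDiff ℝ ∞ ψ) (hφ : ContDiff ℝ ∞ φ)
    (hψconv : ConvexOn ℝ Set.univ ψ)
    (hdet : ∀ x, 0 < (ToricPoincare.hess ψ x).det)
    (hφbdd : BddBelow (Set.range φ))
    (hrange : Set.range (gradient ψ) = K)
    (hstar : ToricPoincare.StarCondition ψ φ)
    (hreg : ToricPoincare.RegularAtInfinity K ψ φ) :
    IsFiniteMeasure (ToricPoincare.nu ψ φ) ∧ ToricPoincare.nu ψ φ Kᶜ = 0 ∧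
      ∀ f : EuclideanSpace ℝ (Fin n) → ℝ, (∃ C : ℝ≥0, LipschitzOnWith C f K) →
        ∫ x in K, f x ∂(ToricPoincare.nu ψ φ) = 0 →
          ∫⁻ x in K, ENNReal.ofReal (f x ^ 2) ∂(ToricPoincare.nu ψ φ) ≤
            ∫⁻ x in K, ToricPoincare.Q ψ x (gradient f x) ∂(ToricPoincare.nu ψ φ) := by
  subst hrange
  have hg := fun x => (ToricPoincare.isUnit_hessOp_iff hψ).2 (hdet x).ne'
  have hfin := ToricPoincare.isFiniteMeasure_mu hψ hψconv hg hφbdd hKbdd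
  have hemb := ToricPoincare.measurableEmbedding_gradient hψ hψconv hg
  have hcompl := ToricPoincare.nu_compl_range (φ := φ) hψ hg
  have hrestrict : (ToricPoincare.nu ψ φ).restrict (range (gradient ψ)) = ToricPoincare.nu ψ φ :=
    Measure.restrict_eq_self_of_ae_mem hcompl
  refine ⟨Measure.isFiniteMeasure_map _ _, hcompl, fun f ⟨C, hf⟩ hmean => ?_⟩
  rw [hrestrict] at hmean ⊢
  rw [ToricPoincare.nu, hemb.integral_map] at hmean
  rw [ToricPoincare.nu, hemb.lintegral_map, hemb.lintegral_map]
  exact ToricPoincare.lintegral_sq_le_lintegral_Q hψ hψconv hg hφ hstar hreg hKbdd hf hmean
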